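/- Let $G=(V,E)$ be a locally finite graph and let $\ell:E\to\mathbb R_{>0}$ assign a length to every edge. Regard $G$ as a 1-complex in which every edge $e$ is a copy of the real interval $[0,\ell(e)]$, and for points $x,y$ of this 1-complex let $d_\ell(x,y)$ be the infimum of the lengths of the $x$–$y$ arcs in it (with $d_\ell(x,y)=\infty$ if there is no such arc). Let $|G|_\ell$ be the completion of the resulting (extended) metric space, and let the boundary $\partial^\ell G$ be the subspace of $|G|_\ell$ consisting of the points that do not belong to the 1-complex $G$. A ray is a one-way infinite path in $G$, two rays are equivalent if no finite set of vertices separates them, and the ends of $G$ are the equivalence classes of rays; the elements of an end $\omega$ are called $\omega$-rays. For an end $\omega$ let $$\partial^\ell\omega=\{x\in\partial^\ell G \mid \text{there is an } \omega\text{-ray whose sequence of vertices converges to } x \text{ in } |G|_\ell\}.$$ Theorem. If $|G|_\ell$ is compact, then $\partial^\ell\omega$ is (non-empty and) connected for every end $\omega$ of $G$. Consequently, the sets $\partial^\ell\omega$, where $\omega$ ranges over the ends of $G$, are precisely the connected components of the space $\partial^\ell G$. -/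

import Mathlib

open scoped ENNReal Topology

/-! ### The metric 1-complex of a graph with edge lengths -/

namespace LTop

variable {V : Type*} {G : SimpleGraph V}

/-- The points of the 1-complex of `G`: the vertices and, for every edge `e`, the inner points of
a copy of the real interval `[0, ℓ e]`, given by their parameter `t` with `0 < t < ℓ e`. -/
inductive OneComplex (G : SimpleGraph V) (ℓ : G.edgeSet → ℝ) : Type _
  | vertex (v : V) : OneComplex G ℓ
  | inner (e : G.edgeSet) (t : ℝ) (t_pos : 0 < t) (t_lt : t < ℓ e) : OneComplex G ℓ

/-- The endvertex of `e` at the parameter `0` of the interval `[0, ℓ e]`. -/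
noncomputable def tail (e : G.edgeSet) : V := (Quot.out (e : Sym2 V)).1

/-- The endvertex of `e` at the parameter `ℓ e` of the interval `[0, ℓ e]`. -/
noncomputable def head (e : G.edgeSet) : V := (Quot.out (e : Sym2 V)).2

/-- The length of a walk: the sum of the lengths of its edges. -/
noncomputable def walkLength (ℓ : G.edgeSet → ℝ) {u v : V} (p : G.Walk u v) : ℝ≥0∞ :=
  (p.darts.map fun d => ENNReal.ofReal (ℓ ⟨d.edge, d.edge_mem⟩)).sum

/-- The distance of two vertices: the infimum of the lengths of the `u`-`v` paths
(`∞` if there are none). -/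
noncomputable def vertexDist (ℓ : G.edgeSet → ℝ) (u v : V) : ℝ≥0∞ :=
  ⨅ p : G.Path u v, walkLength ℓ (p : G.Walk u v)

open scoped Classical in
/-- The length of the half-edge joining the point `x` to the vertex `v`: it is `0` if `x = v`, and
it is `∞` if there is no such half-edge, that is, if `x` is another vertex or an inner point of an
edge that is not incident with `v`. -/
noncomputable def halfEdgeLength {ℓ : G.edgeSet → ℝ} : OneComplex G ℓ → V → ℝ≥0∞
  | .vertex u, v => if v = u then 0 else ⊤
  | .inner e t _ _, v =>
      if v = tail e then ENNReal.ofReal t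
      else if v = head e then ENNReal.ofReal (ℓ e - t)
      else ⊤

open scoped Classical in
/-- The length of the segment between two inner points of the same edge, `∞` otherwise. -/
noncomputable def segmentLength {ℓ : G.edgeSet → ℝ} : OneComplex G ℓ → OneComplex G ℓ → ℝ≥0∞
  | .inner e t _ _, .inner f s _ _ => if e = f then ENNReal.ofReal |t - s| else ⊤
  | _, _ => ⊤

/-- The distance `d_ℓ(x, y)`: the infimum of the lengths of the `x`-`y` arcs in the 1-complex.
Such an arc either stays inside one edge, or it consists of a half-edge from `x` to a vertex `u`
(trivial if `x = u`), a `u`-`v` path in the graph, and a half-edge from a vertex `v` to `y`.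
Some of the concatenations considered here are not injective, but these contain an `x`-`y` arc
that is at most as long, so they do not affect the infimum. -/
noncomputable def arcDist {ℓ : G.edgeSet → ℝ} (x y : OneComplex G ℓ) : ℝ≥0∞ :=
  min (segmentLength x y)
    (⨅ (u : V) (v : V), halfEdgeLength x u + vertexDist ℓ u v + halfEdgeLength y v)

section facts

variable {ℓ : G.edgeSet → ℝ}

theorem walkLength_append {u v w : V} (p : G.Walk u v) (q : G.Walk v w) :
    walkLength ℓ (p.append q) = walkLength ℓ p + walkLength ℓ q := by
  simp [walkLength, SimpleGraph.Walk.darts_append]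

theorem walkLength_reverse {u v : V} (p : G.Walk u v) :
    walkLength ℓ p.reverse = walkLength ℓ p := by
  simp only [walkLength, SimpleGraph.Walk.darts_reverse, List.map_reverse, List.map_map,
    List.sum_reverse]
  congr 1
  apply List.map_congr_left
  intro d _
  simp [Function.comp]

theorem vertexDist_le {u v : V} (p : G.Walk u v) : vertexDist ℓ u v ≤ walkLength ℓ p := by
  classical
  refine (iInf_le _ p.toPath).trans ?_
  exact List.Sublist.sum_le_sum ((p.darts_bypass_sublist_darts).map _) (fun _ _ => zero_le)

theorem vertexDist_self (u : V) : vertexDist ℓ u u = 0 :=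
  le_antisymm ((vertexDist_le SimpleGraph.Walk.nil).trans (by simp [walkLength])) zero_le

theorem vertexDist_comm (u v : V) : vertexDist ℓ u v = vertexDist ℓ v u := by
  have h : ∀ a b : V, vertexDist ℓ a b ≤ vertexDist ℓ b a := fun a b =>
    le_iInf fun p => (vertexDist_le p.1.reverse).trans (walkLength_reverse _).le
  exact le_antisymm (h _ _) (h _ _)

theorem vertexDist_triangle (u v w : V) :
    vertexDist ℓ u w ≤ vertexDist ℓ u v + vertexDist ℓ v w := by
  rw [vertexDist, vertexDist, vertexDist, ENNReal.iInf_add]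
  refine le_iInf fun p => ?_
  rw [ENNReal.add_iInf]
  refine le_iInf fun q => ?_
  exact (vertexDist_le (p.1.append q.1)).trans (walkLength_append _ _).le

theorem segmentLength_comm (x y : OneComplex G ℓ) : segmentLength x y = segmentLength y x := by
  cases x <;> cases y <;> simp only [segmentLength]
  rename_i e t _ _ f s _ _
  rw [abs_sub_comm]
  by_cases h : e = f
  · rw [if_pos h, if_pos h.symm]
  · rw [if_neg h, if_neg (Ne.symm h)]

theorem arcDist_comm (x y : OneComplex G ℓ) : arcDist x y = arcDist y x := by
  unfold arcDist
  rw [segmentLength_comm, iInf_comm]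
  congr 1
  refine iInf_congr fun u => iInf_congr fun v => ?_
  rw [vertexDist_comm]
  ring

theorem arcDist_self (x : OneComplex G ℓ) : arcDist x x = 0 := by
  refine le_antisymm ?_ zero_le
  cases x with
  | vertex v =>
    refine (min_le_right _ _).trans ((iInf₂_le v v).trans ?_)
    simp [halfEdgeLength, vertexDist_self]
  | inner e t h0 h1 =>
    refine (min_le_left _ _).trans ?_
    simp [segmentLength]

theorem segmentLength_triangle (x y z : OneComplex G ℓ) :
    segmentLength x z ≤ segmentLength x y + segmentLength y z := by
  cases x <;> cases y <;> cases z <;> simp only [segmentLength, top_add, add_top, le_top]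
  split_ifs <;> simp_all
  rw [← ENNReal.ofReal_add (abs_nonneg _) (abs_nonneg _)]
  exact ENNReal.ofReal_le_ofReal (abs_sub_le _ _ _)

theorem halfEdgeLength_le (x y : OneComplex G ℓ) (u : V) :
    halfEdgeLength x u ≤ segmentLength x y + halfEdgeLength y u := by
  cases x <;> cases y <;> simp only [segmentLength, top_add, le_top]
  rename_i e t ht0 ht1 f s hs0 hs1
  by_cases hef : e = f
  · subst hef
    have h1 := neg_abs_le (t - s)
    have h2 := le_abs_self (t - s)
    simp only [if_true, halfEdgeLength]
    split_ifs
    · rw [← ENNReal.ofReal_add (abs_nonneg _) hs0.le]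
      exact ENNReal.ofReal_le_ofReal (by linarith)
    · rw [← ENNReal.ofReal_add (abs_nonneg _) (by linarith)]
      exact ENNReal.ofReal_le_ofReal (by linarith)
    · simp
  · simp [hef]

theorem vertexDist_tail_head (e : G.edgeSet) :
    vertexDist ℓ (tail e) (head e) ≤ ENNReal.ofReal (ℓ e) := by
  have he : s(tail e, head e) = (e : Sym2 V) := Quot.out_eq (e : Sym2 V)
  have ha : G.Adj (tail e) (head e) := by
    rw [← SimpleGraph.mem_edgeSet, he]
    exact e.2
  refine (vertexDist_le ha.toWalk).trans ?_
  simp [walkLength, SimpleGraph.Dart.edge, he]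

theorem vertexDist_le_halfEdgeLength (x : OneComplex G ℓ) (u v : V) :
    vertexDist ℓ u v ≤ halfEdgeLength x u + halfEdgeLength x v := by
  by_cases huv : u = v
  · subst huv
    simp [vertexDist_self]
  cases x with
  | vertex w =>
    simp only [halfEdgeLength]
    split_ifs <;> simp_all
  | inner e t h0 h1 =>
    have h := vertexDist_tail_head (ℓ := ℓ) e
    have hs : ENNReal.ofReal (ℓ e) = ENNReal.ofReal t + ENNReal.ofReal (ℓ e - t) := by
      rw [← ENNReal.ofReal_add h0.le (by linarith)]
      congr 1
      ring
    rw [hs] at h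
    simp only [halfEdgeLength]
    by_cases a1 : u = tail e <;> by_cases a2 : v = tail e
    · exact absurd (a1.trans a2.symm) huv
    · by_cases a3 : v = head e
      · subst a1 a3
        simpa [a2] using h
      · simp [a2, a3]
    · by_cases a3 : u = head e
      · subst a2 a3
        rw [vertexDist_comm, add_comm]
        simpa [a1] using h
      · simp [a1, a3]
    · by_cases a3 : u = head e
      · by_cases a4 : v = head e
        · exact absurd (a3.trans a4.symm) huv
        · simp [a2, a4]
      · simp [a1, a3]

theorem arcDist_triangle (x y z : OneComplex G ℓ) :
    arcDist x z ≤ arcDist x y + arcDist y z := by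
  have key : ∀ a b : OneComplex G ℓ, ∀ u v : V,
      arcDist a b ≤ halfEdgeLength a u + vertexDist ℓ u v + halfEdgeLength b v := fun a b u v =>
    (min_le_right _ _).trans ((iInf_le _ u).trans (iInf_le _ v))
  have hxy : arcDist x y = min (segmentLength x y) (⨅ (u : V) (v : V),
    halfEdgeLength x u + vertexDist ℓ u v + halfEdgeLength y v) := rfl
  have hyz : arcDist y z = min (segmentLength y z) (⨅ (u : V) (v : V),
    halfEdgeLength y u + vertexDist ℓ u v + halfEdgeLength z v) := rfl
  rw [hxy, hyz, min_add, add_min, add_min]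
  refine le_min (le_min ?_ ?_) (le_min ?_ ?_)
  · exact (min_le_left _ _).trans (segmentLength_triangle x y z)
  · simp only [ENNReal.add_iInf]
    refine le_iInf fun u => le_iInf fun v => (key x z u v).trans ?_
    simp only [← add_assoc]
    gcongr
    exact halfEdgeLength_le x y u
  · simp only [ENNReal.iInf_add]
    refine le_iInf fun u => le_iInf fun v => (key x z u v).trans ?_
    rw [add_assoc _ (halfEdgeLength y v)]
    gcongr
    rw [segmentLength_comm, add_comm]
    exact halfEdgeLength_le z y v
  · simp only [ENNReal.iInf_add]
    refine le_iInf fun u => le_iInf fun v => ?_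
    simp only [ENNReal.add_iInf]
    refine le_iInf fun u' => le_iInf fun v' => (key x z u v').trans ?_
    calc halfEdgeLength x u + vertexDist ℓ u v' + halfEdgeLength z v'
        ≤ halfEdgeLength x u + (vertexDist ℓ u v + ((halfEdgeLength y v + halfEdgeLength y u')
            + vertexDist ℓ u' v')) + halfEdgeLength z v' := by
          gcongr
          refine (vertexDist_triangle u v v').trans ?_
          gcongr
          refine (vertexDist_triangle v u' v').trans ?_
          gcongr
          exact vertexDist_le_halfEdgeLength y v u'
      _ = _ := by ring

end facts

/-- The 1-complex with the distance `d_ℓ`. Two points in different components of the graph have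
distance `∞`, and points at distance `0` are not identified yet. -/
noncomputable instance (ℓ : G.edgeSet → ℝ) : PseudoEMetricSpace (OneComplex G ℓ) where
  edist := arcDist
  edist_self := arcDist_self
  edist_comm := arcDist_comm
  edist_triangle := arcDist_triangle

/-- The space `|G|_ℓ`: the (Hausdorff) completion of the 1-complex with respect to `d_ℓ`. It
identifies the points at distance `0` from each other. -/
abbrev Completion (G : SimpleGraph V) (ℓ : G.edgeSet → ℝ) : Type _ :=
  UniformSpace.Completion (OneComplex G ℓ)

/-- The boundary `∂^ℓ G`: the points of `|G|_ℓ` that are not images of points of the 1-complex. -/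
def boundary (G : SimpleGraph V) (ℓ : G.edgeSet → ℝ) : Set (Completion G ℓ) :=
  (Set.range fun x : OneComplex G ℓ => (x : Completion G ℓ))ᶜ

/-! ### Rays and ends -/

/-- A ray: a one-way infinite path. -/
structure Ray (G : SimpleGraph V) where
  vert : ℕ → V
  adj : ∀ n, G.Adj (vert n) (vert (n + 1))
  injective : Function.Injective vert

/-- The vertex set `S` separates `A` from `B` in `G`: every walk from `A` to `B` meets `S`. -/
def Separates (G : SimpleGraph V) (S A B : Set V) : Prop :=
  ∀ a ∈ A, ∀ b ∈ B, ∀ p : G.Walk a b, ∃ w ∈ p.support, w ∈ S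

/-- Two rays are equivalent if no finite set of vertices separates them. -/
def Ray.Equivalent (R L : Ray G) : Prop :=
  ¬ ∃ S : Set V, S.Finite ∧ Separates G S (Set.range R.vert) (Set.range L.vert)

theorem Ray.equivalent_iff (R L : Ray G) : R.Equivalent L ↔ ∀ S : Set V, S.Finite →
    ∃ m n, ∃ p : G.Walk (R.vert m) (L.vert n), ∀ w ∈ p.support, w ∉ S := by
  simp only [Ray.Equivalent, Separates]
  push Not
  simp only [Set.exists_range_iff]

theorem Ray.exists_walk_of_le (R : Ray G) (S : Set V) (N : ℕ) (h : ∀ k, N ≤ k → R.vert k ∉ S)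
    (m n : ℕ) (hm : N ≤ m) (hmn : m ≤ n) :
    ∃ p : G.Walk (R.vert m) (R.vert n), ∀ w ∈ p.support, w ∉ S := by
  induction n, hmn using Nat.le_induction with
  | base => exact ⟨.nil, by simpa using h m hm⟩
  | succ n hmn ih =>
    obtain ⟨p, hp⟩ := ih
    refine ⟨p.concat (R.adj n), fun w hw => ?_⟩
    rw [SimpleGraph.Walk.support_concat] at hw
    rcases (by simpa using hw : w ∈ p.support ∨ w = R.vert (n + 1)) with hw | rfl
    · exact hp w hw
    · exact h _ (by omega)

theorem Ray.equivalent_symm {R L : Ray G} (h : R.Equivalent L) : L.Equivalent R := by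
  rw [Ray.equivalent_iff] at h ⊢
  intro S hS
  obtain ⟨m, n, p, hp⟩ := h S hS
  exact ⟨n, m, p.reverse, by simpa using hp⟩

theorem Ray.exists_forall_notMem (R : Ray G) (S : Set V) (hS : S.Finite) :
    ∃ N, ∀ k, N ≤ k → R.vert k ∉ S := by
  obtain ⟨N, hN⟩ := (hS.preimage R.injective.injOn).bddAbove
  exact ⟨N + 1, fun k hk hmem => by have := hN hmem; omega⟩

theorem Ray.equivalent_refl (R : Ray G) : R.Equivalent R := by
  rw [Ray.equivalent_iff]
  intro S hS
  obtain ⟨N, hN⟩ := R.exists_forall_notMem S hS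
  exact ⟨N, N, R.exists_walk_of_le S N hN N N le_rfl le_rfl⟩

theorem Ray.equivalent_trans {R L T : Ray G} (h : R.Equivalent L) (h' : L.Equivalent T) :
    R.Equivalent T := by
  rw [Ray.equivalent_iff] at h h' ⊢
  intro S hS
  obtain ⟨N, hN⟩ := L.exists_forall_notMem S hS
  have hS' : (S ∪ L.vert '' Set.Iio N).Finite := hS.union ((Set.finite_Iio N).image _)
  obtain ⟨m, n, p, hp⟩ := h _ hS'
  obtain ⟨n', k, q, hq⟩ := h' _ hS'
  have hn : N ≤ n := by
    by_contra hlt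
    exact hp _ p.end_mem_support (Or.inr ⟨n, not_le.1 hlt, rfl⟩)
  have hn' : N ≤ n' := by
    by_contra hlt
    exact hq _ q.start_mem_support (Or.inr ⟨n', not_le.1 hlt, rfl⟩)
  obtain ⟨r, hr⟩ : ∃ r : G.Walk (L.vert n) (L.vert n'), ∀ w ∈ r.support, w ∉ S := by
    rcases le_total n n' with hle | hle
    · exact L.exists_walk_of_le S N hN n n' hn hle
    · obtain ⟨r, hr⟩ := L.exists_walk_of_le S N hN n' n hn' hle
      exact ⟨r.reverse, by simpa using hr⟩
  refine ⟨m, k, (p.append r).append q, fun w hw => ?_⟩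
  rw [SimpleGraph.Walk.mem_support_append_iff, SimpleGraph.Walk.mem_support_append_iff] at hw
  rcases hw with (hw | hw) | hw
  · exact fun hS => hp w hw (Or.inl hS)
  · exact hr w hw
  · exact fun hS => hq w hw (Or.inl hS)

/-- Equivalence of rays. -/
def raySetoid (G : SimpleGraph V) : Setoid (Ray G) where
  r := Ray.Equivalent
  iseqv := ⟨Ray.equivalent_refl, Ray.equivalent_symm, Ray.equivalent_trans⟩

/-- The ends of `G`: the equivalence classes of rays. -/
def Ends (G : SimpleGraph V) : Type _ := Quotient (raySetoid G)

/-- `R` is an `ω`-ray: it belongs to the equivalence class `ω`. -/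
def Ray.BelongsTo (R : Ray G) (ω : Ends G) : Prop := Quotient.mk (raySetoid G) R = ω

/-- The ray `R` converges to the point `x` of `|G|_ℓ`. -/
def Ray.ConvergesTo (R : Ray G) (ℓ : G.edgeSet → ℝ) (x : Completion G ℓ) : Prop :=
  Filter.Tendsto (fun n => ((OneComplex.vertex (R.vert n) : OneComplex G ℓ) : Completion G ℓ))
    Filter.atTop (𝓝 x)

/-- The set `∂^ℓ ω` of the boundary points that are limits of `ω`-rays. -/
def endBoundary (ℓ : G.edgeSet → ℝ) (ω : Ends G) : Set (Completion G ℓ) :=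
  {x | x ∈ boundary G ℓ ∧ ∃ R : Ray G, R.BelongsTo ω ∧ R.ConvergesTo ℓ x}

end LTop

namespace LTop

open Filter Set

variable {V : Type*} {G : SimpleGraph V} {ℓ : G.edgeSet → ℝ}

/-! ### Distances in the 1-complex -/

/-! The argument works with vertices only. Let `R` be an ω-ray and, for finite `S`, let C(S) =
`tailComponent R S` be the component of G - S that contains a tail of `R`. The key fact,
`mem_endBoundary_iff`, is that ∂ω is the intersection over all finite `S` of the closures of C(S).
Behind it lie two facts: every boundary point is an accumulation point of vertices, and vertices
close to it are joined by short walks, which avoid `S` and can be concatenated to a ray converging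
to the point.

Hence ∂ω is closed, and compactness makes it nonempty. Suppose it split into two disjoint nonempty
closed parts, with disjoint open neighbourhoods U and U'. Every C(S) has vertices in both, so a walk
between them that avoids `S` contains an edge leaving U. The ends of these edges in U accumulate at
some z in ∂ω. As U and U' are disjoint, z is not in U'. But z is not in U either: compactness leaves
only finitely many edges longer than a given ε (`finite_setOf_le_length`), so the other ends would
also be close to z and hence in U.

For the components, the closures of C(S) and of its complement cover the boundary and do not meet in
it, so a connected subset of the boundary that meets ∂ω lies inside it
(`mem_endBoundary_of_isPreconnected`). -/

theorem edist_eq_arcDist (x y : OneComplex G ℓ) : edist x y = arcDist x y := rfl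

theorem arcDist_le (x y : OneComplex G ℓ) (u v : V) :
    arcDist x y ≤ halfEdgeLength x u + vertexDist ℓ u v + halfEdgeLength y v :=
  (min_le_right _ _).trans ((iInf_le _ u).trans (iInf_le _ v))

theorem edist_vertex_right_le (x : OneComplex G ℓ) (u : V) :
    edist x (.vertex u) ≤ halfEdgeLength x u := by
  refine (arcDist_le x _ u u).trans ?_
  simp [vertexDist_self, halfEdgeLength]

theorem edist_vertex_vertex (u v : V) :
    edist (.vertex u : OneComplex G ℓ) (.vertex v) = vertexDist ℓ u v := by
  refine le_antisymm ((arcDist_le _ _ u v).trans (by simp [halfEdgeLength])) ?_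
  refine le_min (by simp [segmentLength]) (le_iInf₂ fun a b => ?_)
  by_cases ha : a = u
  · by_cases hb : b = v
    · subst ha hb
      simp [halfEdgeLength]
    · simp [halfEdgeLength, hb]
  · simp [halfEdgeLength, ha]

theorem vertexDist_le_of_mem_support {u v w : V} (p : G.Walk u v) (hw : w ∈ p.support) :
    vertexDist ℓ u w ≤ walkLength ℓ p := by
  classical
  refine (vertexDist_le (p.takeUntil w hw)).trans ?_
  conv_rhs => rw [← p.take_spec hw, walkLength_append]
  exact le_self_add

theorem vertexDist_le_of_adj {u v : V} (h : G.Adj u v) :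
    vertexDist ℓ u v ≤ ENNReal.ofReal (ℓ ⟨s(u, v), h⟩) :=
  (vertexDist_le h.toWalk).trans (by simp [walkLength, SimpleGraph.Dart.edge])

/-- A path from `v` to another vertex contains an edge at `v`, and these are finitely many edges of
positive length. -/
theorem exists_pos_le_vertexDist [G.LocallyFinite] (hℓ : ∀ e, 0 < ℓ e) (v : V) :
    ∃ δ : ℝ≥0∞, 0 < δ ∧ ∀ w, w ≠ v → δ ≤ vertexDist ℓ v w := by
  have hev : ∀ᶠ δ : ℝ≥0∞ in 𝓝[>] 0, ∀ w : G.neighborSet v,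
      δ ≤ ENNReal.ofReal (ℓ ⟨s(v, w.1), w.2⟩) := by
    refine eventually_all.2 fun w => ?_
    exact nhdsWithin_le_nhds
      (Iic_mem_nhds (ENNReal.ofReal_pos.2 (hℓ _)))
  obtain ⟨δ, hδ, hpos⟩ := (hev.and self_mem_nhdsWithin).exists
  refine ⟨δ, hpos, fun w hw => le_iInf fun p => ?_⟩
  obtain ⟨p, -⟩ := p
  cases p with
  | nil => exact absurd rfl hw
  | cons h q =>
    refine (hδ ⟨_, h⟩).trans ?_
    simp [walkLength, SimpleGraph.Dart.edge]

theorem min_le_halfEdgeLength (e : G.edgeSet) (t : ℝ) (h0 : 0 < t) (h1 : t < ℓ e) (u : V) :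
    ENNReal.ofReal (min t (ℓ e - t)) ≤ halfEdgeLength (.inner e t h0 h1 : OneComplex G ℓ) u := by
  simp only [halfEdgeLength]
  split_ifs
  · exact ENNReal.ofReal_le_ofReal (min_le_left _ _)
  · exact ENNReal.ofReal_le_ofReal (min_le_right _ _)
  · exact le_top

/-- Every point of the 1-complex has a ball around it that contains only finitely many vertices. -/
theorem exists_pos_finite_setOf_edist_lt [G.LocallyFinite] (hℓ : ∀ e, 0 < ℓ e)
    (x : OneComplex G ℓ) :
    ∃ δ : ℝ≥0∞, 0 < δ ∧ {v : V | edist x (.vertex v) < δ}.Finite := by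
  cases x with
  | vertex v =>
    obtain ⟨δ, hδ, h⟩ := exists_pos_le_vertexDist hℓ v
    refine ⟨δ, hδ, (finite_singleton v).subset fun w hw => ?_⟩
    by_contra hne
    rw [mem_ofPred_eq, edist_vertex_vertex] at hw
    exact absurd hw (not_lt.2 (h w hne))
  | inner e t h0 h1 =>
    -- The radius is the length of the shorter half of `e`, so the ball contains no vertex at all.
    refine ⟨ENNReal.ofReal (min t (ℓ e - t)), ENNReal.ofReal_pos.2 (lt_min h0 (by linarith)),
      finite_empty.subset fun w hw => absurd (show edist _ _ < _ from hw) (not_lt.2 ?_)⟩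
    refine le_min (by simp [segmentLength]) (le_iInf₂ fun a b => ?_)
    rw [add_assoc]
    exact (min_le_halfEdgeLength e t h0 h1 a).trans le_self_add

/-! ### Edges -/

theorem mk_tail_head (e : G.edgeSet) : s(tail e, head e) = (e : Sym2 V) :=
  Quot.out_eq (e : Sym2 V)

theorem tail_ne_head (e : G.edgeSet) : tail e ≠ head e := by
  have h : s(tail e, head e) ∈ G.edgeSet := (mk_tail_head e).symm ▸ e.2
  exact G.ne_of_adj h

open scoped Classical in
/-- The parametrization of the edge `e` by the interval `[0, ℓ e]`. -/
noncomputable def edgePoint (ℓ : G.edgeSet → ℝ) (e : G.edgeSet) (t : ℝ) : OneComplex G ℓ :=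
  if h0 : 0 < t then
    if h1 : t < ℓ e then .inner e t h0 h1 else .vertex (head e)
  else .vertex (tail e)

theorem edist_edgePoint_le (e : G.edgeSet) {s t : ℝ} (hs : s ∈ Icc 0 (ℓ e))
    (ht : t ∈ Icc 0 (ℓ e)) (hst : s ≤ t) :
    edist (edgePoint ℓ e s) (edgePoint ℓ e t) ≤ ENNReal.ofReal (t - s) := by
  obtain ⟨hs0, hs1⟩ := hs
  obtain ⟨ht0, ht1⟩ := ht
  unfold edgePoint
  by_cases h0 : 0 < s
  · have h0' : 0 < t := h0.trans_le hst
    by_cases h1 : t < ℓ e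
    · have h1' : s < ℓ e := hst.trans_lt h1
      simp only [h0, h0', h1, h1', dite_true]
      refine (min_le_left _ _).trans ?_
      rw [segmentLength, if_pos rfl, abs_sub_comm, abs_of_nonneg (by linarith)]
    · obtain rfl : t = ℓ e := by linarith
      by_cases h2 : s < ℓ e
      · simp only [h0, h0', h2, lt_irrefl, dite_true, dite_false]
        refine (edist_vertex_right_le _ _).trans ?_
        simp [halfEdgeLength, (tail_ne_head e).symm]
      · simp [h0, h0', h2]
  · obtain rfl : s = 0 := by linarith
    by_cases h0' : 0 < t
    · by_cases h1 : t < ℓ e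
      · simp only [h0', h1, lt_irrefl, dite_true, dite_false]
        rw [edist_comm]
        refine (edist_vertex_right_le _ _).trans ?_
        simp [halfEdgeLength]
      · obtain rfl : t = ℓ e := by linarith
        simp only [h0', lt_irrefl, dite_true, dite_false]
        rw [edist_vertex_vertex, sub_zero]
        exact vertexDist_tail_head e
    · simp [h0']

/-- The parametrization is 1-Lipschitz. This makes the image of an edge compact, hence closed, in
the completion. -/
theorem continuousOn_edgePoint (e : G.edgeSet) :
    ContinuousOn (edgePoint ℓ e) (Icc 0 (ℓ e)) := by
  refine LipschitzOnWith.continuousOn (K := 1) fun s hs t ht => ?_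
  rw [ENNReal.coe_one, one_mul, edist_dist, Real.dist_eq]
  rcases le_total s t with h | h
  · rw [abs_sub_comm, abs_of_nonneg (by linarith)]
    exact edist_edgePoint_le e hs ht h
  · rw [edist_comm, abs_of_nonneg (by linarith)]
    exact edist_edgePoint_le e ht hs h

/-! ### Neighbourhoods in the completion -/

/-- A vertex, as a point of `|G|_ℓ`. -/
noncomputable def vertexPoint (ℓ : G.edgeSet → ℝ) (v : V) : Completion G ℓ :=
  ((OneComplex.vertex v : OneComplex G ℓ) : Completion G ℓ)

theorem exists_mem_nhds_edist_lt (x : Completion G ℓ) {ε : ℝ≥0∞} (hε : 0 < ε) :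
    ∃ W ∈ 𝓝 x, ∀ a b : OneComplex G ℓ, (a : Completion G ℓ) ∈ W → (b : Completion G ℓ) ∈ W →
      edist a b < ε := by
  have h : {p : OneComplex G ℓ × OneComplex G ℓ | edist p.1 p.2 < ε} ∈
      uniformity (OneComplex G ℓ) := edist_mem_uniformity hε
  rw [← UniformSpace.Completion.comap_coe_eq_uniformity] at h
  obtain ⟨T, hT, hTsub⟩ := h
  obtain ⟨W, hW, hWsub⟩ := mem_prod_same_iff.1 (nhds_prod_eq.symm.trans_le (nhds_le_uniformity x) hT)
  exact ⟨W, hW, fun a b ha hb => hTsub (hWsub ⟨ha, hb⟩ : ((a, b) : _ × _) ∈ _)⟩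

theorem exists_mem_nhds_thickening {x : Completion G ℓ} {U : Set (Completion G ℓ)}
    (hU : U ∈ 𝓝 x) :
    ∃ ε : ℝ≥0∞, 0 < ε ∧ ∃ W ∈ 𝓝 x, ∀ a b : OneComplex G ℓ, (a : Completion G ℓ) ∈ W →
      edist a b < ε → (b : Completion G ℓ) ∈ U := by
  obtain ⟨T, hT, hTU⟩ := UniformSpace.mem_nhds_iff.1 hU
  obtain ⟨D, hD, hDT⟩ := comp_mem_uniformity_sets hT
  obtain ⟨ε, hε, h⟩ := mem_uniformity_edist.1
    (UniformSpace.Completion.uniformContinuous_coe (OneComplex G ℓ) hD)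
  exact ⟨ε, hε, UniformSpace.ball x D, UniformSpace.ball_mem_nhds x hD, fun a b ha hab =>
    hTU (hDT ⟨_, ha, h hab⟩)⟩

theorem exists_coe_mem_of_mem_nhds {x : Completion G ℓ} {U : Set (Completion G ℓ)}
    (hU : U ∈ 𝓝 x) : ∃ a : OneComplex G ℓ, (a : Completion G ℓ) ∈ U := by
  obtain ⟨_, hy, a, rfl⟩ := mem_closure_iff_nhds.1
    (UniformSpace.Completion.denseRange_coe (α := OneComplex G ℓ) x) U hU
  exact ⟨a, hy⟩

/-- This stands in for a countable neighbourhood basis, tested on points of the 1-complex only. Such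
points of `W n` are less than 1/n apart, so for large `n` they all lie within the thickening radius
of one that is close to `x`. -/
theorem exists_seq_nhds (x : Completion G ℓ) :
    ∃ W : ℕ → Set (Completion G ℓ), (∀ n, W n ∈ 𝓝 x) ∧ ∀ U ∈ 𝓝 x, ∀ᶠ n in atTop,
      ∀ a : OneComplex G ℓ, (a : Completion G ℓ) ∈ W n → (a : Completion G ℓ) ∈ U := by
  have hpos : ∀ n : ℕ, (0 : ℝ≥0∞) < (n : ℝ≥0∞)⁻¹ := fun n =>
    ENNReal.inv_pos.2 (ENNReal.natCast_ne_top n)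
  choose W hW h using fun n : ℕ => exists_mem_nhds_edist_lt x (hpos n)
  refine ⟨W, hW, fun U hU => ?_⟩
  obtain ⟨ε, hε, T, hT, hTU⟩ := exists_mem_nhds_thickening hU
  have hlim := ENNReal.tendsto_inv_nat_nhds_zero.eventually_lt_const hε
  filter_upwards [hlim] with n hn a ha
  obtain ⟨b, hb⟩ := exists_coe_mem_of_mem_nhds (inter_mem (hW n) hT)
  exact hTU b a hb.2 ((h n b a hb.1 ha).trans hn)

/-- Every point of `|G|_ℓ` has arbitrarily small neighbourhoods whose vertices are joined by
short walks. -/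
theorem exists_mem_nhds_walk {x : Completion G ℓ} {U : Set (Completion G ℓ)} (hU : U ∈ 𝓝 x) :
    ∃ W ∈ 𝓝 x, ∀ u v : V, vertexPoint ℓ u ∈ W → vertexPoint ℓ v ∈ W →
      ∃ p : G.Walk u v, ∀ w ∈ p.support, vertexPoint ℓ w ∈ U := by
  obtain ⟨ε, hε, W, hW, h⟩ := exists_mem_nhds_thickening hU
  obtain ⟨W', hW', h'⟩ := exists_mem_nhds_edist_lt x hε
  refine ⟨W ∩ W', inter_mem hW hW', fun u v hu hv => ?_⟩
  have huv := h' _ _ hu.2 hv.2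
  rw [edist_vertex_vertex] at huv
  obtain ⟨p, hp⟩ := iInf_lt_iff.1 huv
  refine ⟨p, fun w hw => h _ _ hu.1 ?_⟩
  rw [edist_vertex_vertex]
  exact (vertexDist_le_of_mem_support _ hw).trans_lt hp

/-! ### The boundary and the vertices -/

/-- Without vertices near `x`, short arcs near `x` cannot pass through vertices, so all nearby
points of the 1-complex lie on a single edge. The edge has closed image, so `x` would belong to it.
-/
theorem exists_vertexPoint_mem_of_mem_nhds {x : Completion G ℓ}
    (hx : x ∈ boundary G ℓ) {U : Set (Completion G ℓ)} (hU : U ∈ 𝓝 x) :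
    ∃ v, vertexPoint ℓ v ∈ U := by
  by_contra! hno
  obtain ⟨ε, hε, W, hW, h⟩ := exists_mem_nhds_thickening hU
  obtain ⟨W', hW', h'⟩ := exists_mem_nhds_edist_lt x hε
  have hseg : ∀ a b : OneComplex G ℓ, (a : Completion G ℓ) ∈ W ∩ W' →
      (b : Completion G ℓ) ∈ W ∩ W' → segmentLength a b < ε := by
    intro a b ha hb
    have hab := h' a b ha.2 hb.2
    rw [edist_eq_arcDist, arcDist, min_lt_iff] at hab
    refine hab.resolve_right fun hlt => ?_
    obtain ⟨u, hu⟩ := iInf_lt_iff.1 hlt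
    obtain ⟨v, hv⟩ := iInf_lt_iff.1 hu
    refine hno u (h a _ ha.1 ((edist_vertex_right_le a u).trans_lt (lt_of_le_of_lt ?_ hv)))
    rw [add_assoc]
    exact le_self_add
  obtain ⟨a, ha⟩ := exists_coe_mem_of_mem_nhds (inter_mem hW hW')
  cases a with
  | vertex v => exact absurd (hseg _ _ ha ha) (by simp [segmentLength])
  | inner e t h0 h1 =>
    have hK : IsCompact ((fun s => (edgePoint ℓ e s : Completion G ℓ)) '' Icc 0 (ℓ e)) :=
      isCompact_Icc.image_of_continuousOn
        ((UniformSpace.Completion.continuous_coe _).comp_continuousOn (continuousOn_edgePoint e))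
    have hKx := hK.isClosed.isOpen_compl.mem_nhds (x := x) fun ⟨s, _, hs⟩ => hx ⟨_, hs⟩
    obtain ⟨b, hb, hbK⟩ := exists_coe_mem_of_mem_nhds (inter_mem (inter_mem hW hW') hKx)
    have hab := hseg _ _ ha hb
    cases b with
    | vertex v => exact absurd hab (by simp [segmentLength])
    | inner f s g0 g1 =>
      by_cases hef : e = f
      · subst hef
        exact hbK ⟨s, ⟨g0.le, g1.le⟩, by simp [edgePoint, g0, g1]⟩
      · exact absurd hab (by simp [segmentLength, hef])

/-- Finitely many vertices form a closed set missing `x`, so removing them from a neighbourhood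
leaves a neighbourhood, which contains yet another vertex. -/
theorem mapClusterPt_of_mem_boundary {x : Completion G ℓ}
    (hx : x ∈ boundary G ℓ) : MapClusterPt x cofinite (vertexPoint ℓ) := by
  rw [mapClusterPt_iff_frequently]
  intro U hU
  rw [frequently_cofinite_iff_infinite]
  intro hfin
  have hclosed : IsClosed (vertexPoint ℓ '' {v | vertexPoint ℓ v ∈ U}) :=
    (hfin.image _).isClosed
  have hmem : (vertexPoint ℓ '' {v | vertexPoint ℓ v ∈ U})ᶜ ∈ 𝓝 x :=
    hclosed.isOpen_compl.mem_nhds fun ⟨v, _, hv⟩ => hx ⟨_, hv⟩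
  obtain ⟨v, hv⟩ := exists_vertexPoint_mem_of_mem_nhds hx (inter_mem hU hmem)
  exact hv.2 ⟨v, hv.1, rfl⟩

theorem mem_boundary_of_mapClusterPt [G.LocallyFinite] (hℓ : ∀ e, 0 < ℓ e) {x : Completion G ℓ}
    (hx : MapClusterPt x cofinite (vertexPoint ℓ)) : x ∈ boundary G ℓ := by
  rintro ⟨y, rfl⟩
  obtain ⟨δ, hδ, hfin⟩ := exists_pos_finite_setOf_edist_lt hℓ y
  have hball := Metric.eball_mem_nhds y hδ
  rw [(UniformSpace.Completion.isUniformInducing_coe (OneComplex G ℓ)).isInducing.nhds_eq_comap]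
    at hball
  obtain ⟨U, hU, hsub⟩ := hball
  have := (mapClusterPt_iff_frequently.1 hx) U hU
  rw [frequently_cofinite_iff_infinite] at this
  exact this (hfin.subset fun v hv => Metric.mem_eball'.1 (hsub hv))

/-! ### Rays converging to a boundary point -/

/-- A sequence of vertices in which consecutive vertices are adjacent and no vertex is repeated
infinitely often contains a ray. -/
theorem exists_ray_subseq (w : ℕ → V) (hadj : ∀ n, G.Adj (w n) (w (n + 1)))
    (hfin : ∀ v, {n | w n = v}.Finite) :
    ∃ R : Ray G, ∃ i : ℕ → ℕ, StrictMono i ∧ ∀ n, R.vert n = w (i n) := by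
  have hlast : ∀ n, ∃ m, n ≤ m ∧ w m = w n ∧ ∀ k, m < k → w k ≠ w n := by
    intro n
    obtain ⟨m, hm, hmax⟩ := (hfin (w n)).exists_maximal ⟨n, rfl⟩
    refine ⟨m, ?_, hm, fun k hk hkn => absurd (hmax (show k ∈ {k | w k = w n} from hkn) hk.le)
      (not_le.2 hk)⟩
    by_contra! h
    exact absurd (hmax (show n ∈ {k | w k = w n} from rfl) h.le) (not_le.2 h)
  choose last hle heq hgt using hlast
  -- Each step moves on from the last visit to the current vertex and jumps to the last visit of the
  -- next one, so no vertex recurs.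
  let i : ℕ → ℕ := fun n => Nat.rec (last 0) (fun _ k => last (k + 1)) n
  have hi : ∀ n, i (n + 1) = last (i n + 1) := fun _ => rfl
  have hmono : StrictMono i := strictMono_nat_of_lt_succ fun n => by
    have := hle (i n + 1)
    rw [hi]
    omega
  have hgt' : ∀ n k, i n < k → w k ≠ w (i n) := by
    intro n k hk
    cases n with
    | zero => exact (heq 0).symm ▸ hgt 0 k hk
    | succ n =>
      rw [hi] at hk ⊢
      rw [heq]
      exact hgt _ k hk
  refine ⟨⟨fun n => w (i n), fun n => ?_, ?_⟩, i, hmono, fun _ => rfl⟩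
  · rw [hi, heq]
    exact hadj _
  · intro m n hmn
    by_contra hne
    rcases lt_or_gt_of_ne hne with h | h
    · exact hgt' _ _ (hmono h) hmn.symm
    · exact hgt' _ _ (hmono h) hmn

/-- The concatenation of the first `n` walks of a sequence of walks. -/
def concatWalks (v : ℕ → V) (p : ∀ n, G.Walk (v n) (v (n + 1))) : ∀ n, G.Walk (v 0) (v n)
  | 0 => .nil
  | n + 1 => (concatWalks v p n).append (p n)

/-- Infinitely many nontrivial walks, each starting at the end of its predecessor, can be
concatenated. -/
theorem exists_seq_of_walks (v : ℕ → V) (hv : ∀ n, v n ≠ v (n + 1))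
    (p : ∀ n, G.Walk (v n) (v (n + 1))) :
    ∃ w : ℕ → V, (∀ n, G.Adj (w n) (w (n + 1))) ∧
      ∀ K, ∃ N, ∀ n, N ≤ n → ∃ k, K ≤ k ∧ w n ∈ (p k).support := by
  let q := concatWalks v p
  have hq : ∀ n, q (n + 1) = (q n).append (p n) := fun _ => rfl
  have hstep : ∀ n, (q n).length < (q (n + 1)).length := fun n => by
    have : (p n).length ≠ 0 := fun h => hv n (SimpleGraph.Walk.eq_of_length_eq_zero h)
    rw [hq, SimpleGraph.Walk.length_append]
    omega
  have hmono : StrictMono fun n => (q n).length := strictMono_nat_of_lt_succ hstep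
  have hlen : ∀ n, n ≤ (q n).length := fun _ => hmono.le_apply
  -- The walks `q n` extend one another, so reading position `n` off `q n` gives one infinite
  -- sequence.
  have hstable : ∀ m n k, m ≤ n → k ≤ (q m).length → (q n).getVert k = (q m).getVert k := by
    intro m n k hmn hk
    induction n, hmn using Nat.le_induction with
    | base => rfl
    | succ n hmn ih =>
      rw [hq, SimpleGraph.Walk.getVert_append', if_pos (hk.trans (hmono.monotone hmn)), ih]
  refine ⟨fun n => (q n).getVert n, fun n => ?_, fun K => ⟨(q K).length, fun n hn => ?_⟩⟩
  · show G.Adj ((q n).getVert n) ((q (n + 1)).getVert (n + 1))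
    rw [← hstable n (n + 1) n n.le_succ (hlen n)]
    exact (q (n + 1)).adj_getVert_succ (hlen (n + 1))
  · show ∃ k, K ≤ k ∧ (q n).getVert n ∈ (p k).support
    have key : ∀ m, K ≤ m → ∀ j, (q K).length ≤ j → j ≤ (q m).length →
        ∃ k, K ≤ k ∧ (q m).getVert j ∈ (p k).support := by
      intro m hm
      induction m, hm using Nat.le_induction with
      | base =>
        intro j h1 h2
        obtain rfl : j = (q K).length := le_antisymm h2 h1
        exact ⟨K, le_rfl, by simp⟩
      | succ m hm ih =>
        intro j h1 h2
        rw [hq, SimpleGraph.Walk.getVert_append']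
        split_ifs with h
        · exact ih j h1 h
        · exact ⟨m, hm, SimpleGraph.Walk.getVert_mem_support _ _⟩
    rcases le_total K n with h | h
    · exact key n h n hn (hlen n)
    · obtain rfl : K = n := le_antisymm ((hlen K).trans hn) h
      exact key K le_rfl K hn (hlen K)

theorem exists_ray_convergesTo {x : Completion G ℓ}
    (hx : x ∈ boundary G ℓ) : ∃ R : Ray G, R.ConvergesTo ℓ x := by
  obtain ⟨U, hU, hbasis⟩ := exists_seq_nhds x
  choose W hW hwalk using fun n => exists_mem_nhds_walk (hU n)
  -- Choosing from `W n ∩ W (n + 1)` puts consecutive vertices into a common `W n`; avoiding `u`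
  -- keeps the walks nontrivial.
  have hnext : ∀ n (u : V), ∃ v, v ≠ u ∧ vertexPoint ℓ v ∈ W n ∩ W (n + 1) := by
    intro n u
    have h := mapClusterPt_iff_frequently.1 (mapClusterPt_of_mem_boundary hx) _
      (inter_mem (hW n) (hW (n + 1)))
    obtain ⟨v, hv, hvu⟩ := (h.and_eventually (finite_singleton u).compl_mem_cofinite).exists
    exact ⟨v, hvu, hv⟩
  choose next hne hmem using hnext
  obtain ⟨v₀, hv₀⟩ := exists_vertexPoint_mem_of_mem_nhds hx (hW 0)
  let v : ℕ → V := fun n => Nat.rec v₀ (fun n u => next n u) n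
  have hv : ∀ n, v (n + 1) = next n (v n) := fun _ => rfl
  have hvW : ∀ n, vertexPoint ℓ (v n) ∈ W n := by
    intro n
    cases n with
    | zero => exact hv₀
    | succ n => exact (hmem n (v n)).2
  choose p hp using fun n => hwalk n (v n) (v (n + 1)) (hvW n) (hmem n (v n)).1
  obtain ⟨w, hadj, hw⟩ := exists_seq_of_walks v (fun n => (hne n (v n)).symm) p
  have hlim : Tendsto (fun n => vertexPoint ℓ (w n)) atTop (𝓝 x) := by
    refine fun T hT => ?_
    obtain ⟨K, hK⟩ := eventually_atTop.1 (hbasis T hT)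
    obtain ⟨N, hN⟩ := hw K
    refine mem_map.2 (mem_atTop_sets.2 ⟨N, fun n hn => ?_⟩)
    obtain ⟨k, hk, hmk⟩ := hN n hn
    exact hK k hk _ (hp k _ hmk)
  have hfin : ∀ u, {n | w n = u}.Finite := by
    intro u
    have hxu : x ≠ vertexPoint ℓ u := fun h => hx ⟨_, h.symm⟩
    have hev := hlim.eventually_ne hxu
    rw [← Nat.cofinite_eq_atTop] at hev
    exact hev.subset fun n hn h => h (congrArg (vertexPoint ℓ) hn)
  obtain ⟨R, i, hi, hR⟩ := exists_ray_subseq w hadj hfin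
  refine ⟨R, ?_⟩
  simp only [Ray.ConvergesTo, hR]
  exact hlim.comp hi.tendsto_atTop

/-! ### Connecting vertices outside a set -/

/-- There is a `u`-`v` walk that avoids `S`. -/
def JoinedOutside (G : SimpleGraph V) (S : Set V) (u v : V) : Prop :=
  ∃ p : G.Walk u v, ∀ w ∈ p.support, w ∉ S

theorem JoinedOutside.symm {S : Set V} {u v : V} (h : JoinedOutside G S u v) :
    JoinedOutside G S v u := by
  obtain ⟨p, hp⟩ := h
  exact ⟨p.reverse, by simpa using hp⟩

theorem JoinedOutside.trans {S : Set V} {u v w : V} (h : JoinedOutside G S u v)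
    (h' : JoinedOutside G S v w) : JoinedOutside G S u w := by
  obtain ⟨p, hp⟩ := h
  obtain ⟨q, hq⟩ := h'
  refine ⟨p.append q, fun z hz => ?_⟩
  rw [SimpleGraph.Walk.mem_support_append_iff] at hz
  exact hz.elim (hp z) (hq z)

theorem JoinedOutside.anti {S T : Set V} (hST : S ⊆ T) {u v : V} (h : JoinedOutside G T u v) :
    JoinedOutside G S u v := by
  obtain ⟨p, hp⟩ := h
  exact ⟨p, fun w hw hS => hp w hw (hST hS)⟩

theorem JoinedOutside.right_notMem {S : Set V} {u v : V} (h : JoinedOutside G S u v) : v ∉ S := by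
  obtain ⟨p, hp⟩ := h
  exact hp v p.end_mem_support

/-- Around a boundary point, vertices are joined outside any given finite set. -/
theorem exists_mem_nhds_joinedOutside {x : Completion G ℓ} (hx : x ∈ boundary G ℓ) {S : Set V}
    (hS : S.Finite) :
    ∃ W ∈ 𝓝 x, ∀ u v : V, vertexPoint ℓ u ∈ W → vertexPoint ℓ v ∈ W → JoinedOutside G S u v := by
  have hU : (vertexPoint ℓ '' S)ᶜ ∈ 𝓝 x :=
    (hS.image _).isClosed.isOpen_compl.mem_nhds fun ⟨v, _, hv⟩ => hx ⟨_, hv⟩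
  obtain ⟨W, hW, h⟩ := exists_mem_nhds_walk hU
  refine ⟨W, hW, fun u v hu hv => ?_⟩
  obtain ⟨p, hp⟩ := h u v hu hv
  exact ⟨p, fun w hw hwS => hp w hw ⟨w, hwS, rfl⟩⟩

/-- The vertices of the component of `G - S` that contains a tail of the ray `R`. -/
def tailComponent (R : Ray G) (S : Set V) : Set V :=
  {v | ∃ n, (∀ k, n ≤ k → R.vert k ∉ S) ∧ JoinedOutside G S (R.vert n) v}

theorem joinedOutside_of_mem_tailComponent {R : Ray G} {S : Set V} {u v : V}
    (hu : u ∈ tailComponent R S) (hv : v ∈ tailComponent R S) : JoinedOutside G S u v := by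
  obtain ⟨m, hm, hmu⟩ := hu
  obtain ⟨n, hn, hnv⟩ := hv
  have hmn : JoinedOutside G S (R.vert m) (R.vert n) := by
    rcases le_total m n with h | h
    · exact R.exists_walk_of_le S m hm m n le_rfl h
    · exact JoinedOutside.symm (R.exists_walk_of_le S n hn n m le_rfl h)
  exact (hmu.symm.trans hmn).trans hnv

theorem JoinedOutside.mem_tailComponent {R : Ray G} {S : Set V} {u v : V}
    (h : JoinedOutside G S u v) (hu : u ∈ tailComponent R S) : v ∈ tailComponent R S := by
  obtain ⟨n, hn, hnu⟩ := hu
  exact ⟨n, hn, hnu.trans h⟩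

theorem tailComponent_anti (R : Ray G) {S T : Set V} (hST : S ⊆ T) :
    tailComponent R T ⊆ tailComponent R S := fun _ ⟨n, hn, h⟩ =>
  ⟨n, fun k hk hS => hn k hk (hST hS), h.anti hST⟩

theorem notMem_of_mem_tailComponent (R : Ray G) (S : Set V) {v : V} (hv : v ∈ tailComponent R S) :
    v ∉ S := by
  obtain ⟨n, -, h⟩ := hv
  exact h.right_notMem

theorem eventually_vert_mem_tailComponent {R L : Ray G} (h : R.Equivalent L) {S : Set V}
    (hS : S.Finite) : ∀ᶠ n in atTop, L.vert n ∈ tailComponent R S := by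
  obtain ⟨M, hM⟩ := R.exists_forall_notMem S hS
  obtain ⟨N, hN⟩ := L.exists_forall_notMem S hS
  -- Deleting initial segments along with `S` forces the walk to join the tails of the two rays that
  -- avoid `S`.
  obtain ⟨m, n, hmn⟩ := (Ray.equivalent_iff R L).1 h
    (S ∪ (R.vert '' Iio M ∪ L.vert '' Iio N))
    (hS.union (((finite_Iio M).image _).union ((finite_Iio N).image _)))
  have hm : M ≤ m := by
    by_contra! hlt
    exact JoinedOutside.right_notMem (JoinedOutside.symm hmn) (.inr (.inl ⟨m, hlt, rfl⟩))
  have hn : N ≤ n := by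
    by_contra! hlt
    exact JoinedOutside.right_notMem hmn (.inr (.inr ⟨n, hlt, rfl⟩))
  filter_upwards [eventually_ge_atTop n] with k hk
  exact ⟨m, fun j hj => hM j (hm.trans hj), (JoinedOutside.anti subset_union_left hmn).trans
    (L.exists_walk_of_le S N hN n k hn hk)⟩

/-! ### The boundary of an end -/

theorem mem_boundary_of_forall_mem_closure [G.LocallyFinite] (hℓ : ∀ e, 0 < ℓ e) {R : Ray G}
    {x : Completion G ℓ}
    (h : ∀ S : Set V, S.Finite → x ∈ closure (vertexPoint ℓ '' tailComponent R S)) :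
    x ∈ boundary G ℓ := by
  refine mem_boundary_of_mapClusterPt hℓ (mapClusterPt_iff_frequently.2 fun U hU => ?_)
  rw [frequently_cofinite_iff_infinite]
  intro hfin
  -- The hypothesis is applied with `S` the finite set of vertices in `U` itself.
  obtain ⟨_, hvU, v, hv, rfl⟩ := mem_closure_iff_nhds.1 (h _ hfin) U hU
  exact notMem_of_mem_tailComponent R _ hv hvU

/-- This description turns ∂ω into an intersection of closed sets. For the converse, some ray `L`
converges to `x`; a vertex of the tail component near `x` is joined outside `S` both to `R` and to a
vertex of `L`, so `L` is equivalent to `R`. -/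
theorem mem_endBoundary_iff [G.LocallyFinite] (hℓ : ∀ e, 0 < ℓ e) (R : Ray G)
    (x : Completion G ℓ) :
    x ∈ endBoundary ℓ (Quotient.mk (raySetoid G) R) ↔
      ∀ S : Set V, S.Finite → x ∈ closure (vertexPoint ℓ '' tailComponent R S) := by
  constructor
  · rintro ⟨-, L, hL, hx⟩ S hS
    have hRL : R.Equivalent L := Ray.equivalent_symm (Quotient.exact hL)
    exact mem_closure_of_tendsto hx
      ((eventually_vert_mem_tailComponent hRL hS).mono fun n hn => ⟨_, hn, rfl⟩)
  · intro h
    have hx := mem_boundary_of_forall_mem_closure hℓ h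
    obtain ⟨L, hL⟩ := exists_ray_convergesTo hx
    refine ⟨hx, L, Quotient.sound (Ray.equivalent_symm ?_), hL⟩
    refine (Ray.equivalent_iff R L).2 fun S hS => ?_
    obtain ⟨W, hW, hjoin⟩ := exists_mem_nhds_joinedOutside hx hS
    obtain ⟨_, hvW, v, ⟨m, -, hmv⟩, rfl⟩ := mem_closure_iff_nhds.1 (h S hS) W hW
    obtain ⟨n, hn⟩ := (hL.eventually_mem hW).exists
    exact ⟨m, n, hmv.trans (hjoin v _ hvW hn)⟩

theorem mem_endBoundary_of_isPreconnected [G.LocallyFinite] (hℓ : ∀ e, 0 < ℓ e) {ω : Ends G}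
    {K : Set (Completion G ℓ)} (hK : IsPreconnected K) (hKb : K ⊆ boundary G ℓ)
    {x y : Completion G ℓ} (hx : x ∈ K) (hy : y ∈ K) (hxω : x ∈ endBoundary ℓ ω) :
    y ∈ endBoundary ℓ ω := by
  obtain ⟨R, rfl⟩ := Quotient.exists_rep ω
  rw [mem_endBoundary_iff hℓ] at hxω ⊢
  intro S hS
  by_contra hyS
  have hcover : ∀ z ∈ boundary G ℓ, z ∈ closure (vertexPoint ℓ '' tailComponent R S) ∪
      closure (vertexPoint ℓ '' (tailComponent R S)ᶜ) := by
    intro z hz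
    rw [← closure_union, ← image_union, union_compl_self, mem_closure_iff_nhds]
    intro U hU
    obtain ⟨v, hv⟩ := exists_vertexPoint_mem_of_mem_nhds hz hU
    exact ⟨_, hv, v, trivial, rfl⟩
  obtain ⟨z, hzK, hz1, hz2⟩ := isPreconnected_closed_iff.1 hK _ _ isClosed_closure isClosed_closure
    (fun z hz => hcover z (hKb hz)) ⟨x, hx, hxω S hS⟩
    ⟨y, hy, (hcover y (hKb hy)).resolve_left hyS⟩
  obtain ⟨W, hW, hjoin⟩ := exists_mem_nhds_joinedOutside (hKb hzK) hS
  obtain ⟨_, huW, u, hu, rfl⟩ := mem_closure_iff_nhds.1 hz1 W hW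
  obtain ⟨_, hvW, v, hv, rfl⟩ := mem_closure_iff_nhds.1 hz2 W hW
  exact hv ((hjoin u v huW hvW).mem_tailComponent hu)

/-! ### Compactness -/

/-- If `|G|_ℓ` is compact, then only finitely many edges are long: the midpoints of long edges are
far apart. -/
theorem finite_setOf_le_length [CompactSpace (Completion G ℓ)] {ε : ℝ} (hε : 0 < ε) :
    {e : G.edgeSet | ε ≤ ℓ e}.Finite := by
  by_contra hinf
  let mid : G.edgeSet → Completion G ℓ := fun e => (edgePoint ℓ e (ℓ e / 2) : Completion G ℓ)
  have : (cofinite ⊓ 𝓟 {e : G.edgeSet | ε ≤ ℓ e}).NeBot := Set.Infinite.cofinite_inf_principal_neBot hinf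
  obtain ⟨z, hz⟩ := exists_clusterPt_of_compactSpace
    (map mid (cofinite ⊓ 𝓟 {e : G.edgeSet | ε ≤ ℓ e}))
  have hz' : MapClusterPt z (cofinite ⊓ 𝓟 {e : G.edgeSet | ε ≤ ℓ e}) mid := hz
  obtain ⟨W, hW, h⟩ := exists_mem_nhds_edist_lt z (ENNReal.ofReal_pos.2 (half_pos hε))
  have hfreq := mapClusterPt_iff_frequently.1 hz' W hW
  have hlong : ∀ᶠ e in cofinite ⊓ 𝓟 {e : G.edgeSet | ε ≤ ℓ e}, ε ≤ ℓ e :=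
    mem_inf_of_right (mem_principal_self _)
  obtain ⟨e, heW, he⟩ := (hfreq.and_eventually hlong).exists
  obtain ⟨f, ⟨hfW, hf⟩, hfe⟩ := ((hfreq.and_eventually hlong).and_eventually
    (mem_inf_of_left (finite_singleton e).compl_mem_cofinite)).exists
  have hef : e ≠ f := fun h => hfe h.symm
  have hmid : ∀ g : G.edgeSet, ε ≤ ℓ g → ∃ h0 h1,
      edgePoint ℓ g (ℓ g / 2) = .inner g (ℓ g / 2) h0 h1 := fun g hg => by
    have h0 : 0 < ℓ g / 2 := by linarith
    have h1 : ℓ g / 2 < ℓ g := by linarith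
    exact ⟨h0, h1, by simp only [edgePoint, h0, h1, dite_true]⟩
  have hd := h _ _ heW hfW
  obtain ⟨h0, h1, hme⟩ := hmid e he
  obtain ⟨g0, g1, hmf⟩ := hmid f hf
  rw [hme, hmf] at hd
  -- An arc between the midpoints of distinct edges passes through a vertex, and reaching it from
  -- the first midpoint already costs at least ε / 2.
  refine absurd hd (not_lt.2 (le_min (by simp [segmentLength, hef]) (le_iInf₂ fun a b => ?_)))
  rw [add_assoc]
  refine le_trans ?_ ((min_le_halfEdgeLength e _ h0 h1 a).trans le_self_add)
  exact ENNReal.ofReal_le_ofReal (le_min (by linarith) (by linarith))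

theorem finite_long_edge_ends [CompactSpace (Completion G ℓ)] {ε : ℝ} (hε : 0 < ε) :
    ∃ S : Set V, S.Finite ∧ ∀ u v : V, ∀ h : G.Adj u v, u ∉ S → ℓ ⟨s(u, v), h⟩ < ε := by
  have hfin := finite_setOf_le_length (G := G) (ℓ := ℓ) hε
  refine ⟨tail '' {e : G.edgeSet | ε ≤ ℓ e} ∪ head '' {e : G.edgeSet | ε ≤ ℓ e},
    (hfin.image _).union (hfin.image _), fun u v h hu => ?_⟩
  by_contra! hle
  have hmem : u ∈ s(tail ⟨s(u, v), h⟩, head ⟨s(u, v), h⟩) := by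
    rw [mk_tail_head]
    exact Sym2.mem_mk_left u v
  rcases Sym2.mem_iff.1 hmem with h' | h'
  · exact hu (.inl ⟨_, hle, h'.symm⟩)
  · exact hu (.inr ⟨_, hle, h'.symm⟩)

/-- The family is directed because `A S` shrinks as `S` grows. It is applied to tail components and
to the ends of edges leaving an open set. -/
theorem nonempty_iInter_closure [CompactSpace (Completion G ℓ)] (A : Set V → Set V)
    (hA : ∀ S, S.Finite → (A S).Nonempty) (hanti : ∀ S T, S ⊆ T → A T ⊆ A S) :
    ∃ x, ∀ S : Set V, S.Finite → x ∈ closure (vertexPoint ℓ '' A S) := by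
  obtain ⟨x, hx⟩ := IsCompact.nonempty_iInter_of_directed_nonempty_isCompact_isClosed
    (fun S : Finset V => closure (vertexPoint ℓ '' A S))
    (by
      classical
      intro S T
      refine ⟨S ∪ T, ?_, ?_⟩
      · exact closure_mono (image_mono (hanti _ _ (by simp)))
      · exact closure_mono (image_mono (hanti _ _ (by simp))))
    (fun S => ((hA S S.finite_toSet).image _).closure)
    (fun S => isClosed_closure.isCompact) (fun S => isClosed_closure)
  refine ⟨x, fun S hS => ?_⟩
  simpa using mem_iInter.1 hx hS.toFinset

theorem exists_adj_of_walk {P : V → Prop} {u v : V} (p : G.Walk u v) (hu : P u) (hv : ¬ P v) :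
    ∃ a b, G.Adj a b ∧ a ∈ p.support ∧ P a ∧ ¬ P b := by
  induction p with
  | nil => exact absurd hu hv
  | @cons a b c h p ih =>
    by_cases hb : P b
    · obtain ⟨a', b', h1, h2, h3⟩ := ih hb hv
      exact ⟨a', b', h1, by simp [h2], h3⟩
    · exact ⟨a, b, h, by simp, hu, hb⟩

theorem isConnected_endBoundary [G.LocallyFinite] (hℓ : ∀ e, 0 < ℓ e)
    [CompactSpace (Completion G ℓ)] (ω : Ends G) : IsConnected (endBoundary ℓ ω) := by
  obtain ⟨R, rfl⟩ := Quotient.exists_rep ω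
  constructor
  · obtain ⟨x, hx⟩ := nonempty_iInter_closure (ℓ := ℓ) (tailComponent R)
      (fun S hS => (eventually_vert_mem_tailComponent R.equivalent_refl hS).exists.imp'
        R.vert fun _ h => h)
      (fun S T => tailComponent_anti R)
    exact ⟨x, (mem_endBoundary_iff hℓ R x).2 hx⟩
  have hclosed : IsClosed (endBoundary ℓ (Quotient.mk (raySetoid G) R)) := by
    have : endBoundary ℓ (Quotient.mk (raySetoid G) R) =
        ⋂ (S : Set V) (_ : S.Finite), closure (vertexPoint ℓ '' tailComponent R S) := by
      ext x
      simp only [mem_endBoundary_iff hℓ, mem_iInter]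
    rw [this]
    exact isClosed_iInter fun S => isClosed_iInter fun _ => isClosed_closure
  rw [isPreconnected_closed_iff]
  intro A B hA hB hcover ⟨a, haω, haA⟩ ⟨b, hbω, hbB⟩
  set E := endBoundary ℓ (Quotient.mk (raySetoid G) R)
  by_contra hempty
  have hdisj : Disjoint (E ∩ A) (E ∩ B) := by
    rw [Set.disjoint_left]
    exact fun x hx hx' => hempty ⟨x, hx.1, hx.2, hx'.2⟩
  obtain ⟨U, U', hU, hU', hAU, hBU, hUU⟩ := SeparatedNhds.of_isCompact_isCompact
    (hclosed.inter hA).isCompact (hclosed.inter hB).isCompact hdisj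
  -- The point `z` is a limit of ends, in `U`, of edges that leave `U`, chosen in every tail
  -- component.
  obtain ⟨z, hz⟩ := nonempty_iInter_closure (ℓ := ℓ)
    (fun S => {u | u ∈ tailComponent R S ∧ vertexPoint ℓ u ∈ U ∧
      ∃ v, G.Adj u v ∧ vertexPoint ℓ v ∉ U})
    (by
      intro S hS
      obtain ⟨_, huU, u, hu, rfl⟩ := mem_closure_iff_nhds.1 ((mem_endBoundary_iff hℓ R a).1 haω S hS)
        U (hU.mem_nhds (hAU ⟨haω, haA⟩))
      obtain ⟨_, hvU, v, hv, rfl⟩ := mem_closure_iff_nhds.1 ((mem_endBoundary_iff hℓ R b).1 hbω S hS)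
        U' (hU'.mem_nhds (hBU ⟨hbω, hbB⟩))
      obtain ⟨p, hp⟩ := joinedOutside_of_mem_tailComponent hu hv
      obtain ⟨c, d, hcd, hc, hcU, hdU⟩ := exists_adj_of_walk (P := fun w => vertexPoint ℓ w ∈ U) p huU
        (fun h => Set.disjoint_left.1 hUU h hvU)
      classical
      refine ⟨c, JoinedOutside.mem_tailComponent ⟨p.takeUntil c hc, fun w hw => ?_⟩ hu, hcU, d,
        hcd, hdU⟩
      exact hp w (p.support_takeUntil_subset_support hc hw))
    (fun S T hST u hu => ⟨tailComponent_anti R hST hu.1, hu.2⟩)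
  have hzE : z ∈ E := (mem_endBoundary_iff hℓ R z).2 fun S hS =>
    closure_mono (image_mono fun u hu => hu.1) (hz S hS)
  rcases hcover hzE with hzA | hzB
  -- With the ends of long edges put into `S`, an edge starting near `z` is too short to leave `U`.
  · obtain ⟨ε, hε, W, hW, hthick⟩ := exists_mem_nhds_thickening (hU.mem_nhds (hAU ⟨hzE, hzA⟩))
    obtain ⟨δ, hδ, hδε⟩ : ∃ δ : ℝ, 0 < δ ∧ ENNReal.ofReal δ ≤ ε := by
      obtain ⟨δ, hδ, hlt⟩ := ENNReal.lt_iff_exists_nnreal_btwn.1 hε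
      exact ⟨δ, by simpa using hδ, by simpa using hlt.le⟩
    obtain ⟨S, hS, hshort⟩ := finite_long_edge_ends (G := G) (ℓ := ℓ) hδ
    obtain ⟨_, huW, u, ⟨hu, -, v, huv, hv⟩, rfl⟩ := mem_closure_iff_nhds.1 (hz S hS) W hW
    refine hv (hthick _ _ huW ?_)
    rw [edist_vertex_vertex]
    refine lt_of_lt_of_le ((vertexDist_le_of_adj huv).trans_lt ?_) hδε
    exact (ENNReal.ofReal_lt_ofReal_iff hδ).2 (hshort u v huv (notMem_of_mem_tailComponent R S hu))
  · obtain ⟨_, huU', u, ⟨-, huU, -⟩, rfl⟩ := mem_closure_iff_nhds.1 (hz ∅ finite_empty) U'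
      (hU'.mem_nhds (hBU ⟨hzE, hzB⟩))
    exact Set.disjoint_left.1 hUU huU huU'

theorem exists_mem_endBoundary {x : Completion G ℓ} (hx : x ∈ boundary G ℓ) :
    ∃ ω : Ends G, x ∈ endBoundary ℓ ω := by
  obtain ⟨R, hR⟩ := exists_ray_convergesTo hx
  exact ⟨Quotient.mk (raySetoid G) R, hx, R, rfl, hR⟩

theorem connectedComponentIn_boundary [G.LocallyFinite] (hℓ : ∀ e, 0 < ℓ e)
    [CompactSpace (Completion G ℓ)] {ω : Ends G} {x : Completion G ℓ}
    (hx : x ∈ endBoundary ℓ ω) : connectedComponentIn (boundary G ℓ) x = endBoundary ℓ ω := by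
  refine Subset.antisymm (fun y hy => ?_) ?_
  · exact mem_endBoundary_of_isPreconnected hℓ isPreconnected_connectedComponentIn
      (connectedComponentIn_subset _ _) (mem_connectedComponentIn hx.1) hy hx
  · exact (isConnected_endBoundary hℓ ω).isPreconnected.subset_connectedComponentIn hx
      fun y hy => hy.1

end LTop

theorem mainTheorem4 {V : Type*} (G : SimpleGraph V) [G.LocallyFinite] (ℓ : G.edgeSet → ℝ)
    (hℓ : ∀ e, 0 < ℓ e) (hcompact : CompactSpace (LTop.Completion G ℓ)) :
    (∀ ω : LTop.Ends G, IsConnected (LTop.endBoundary ℓ ω)) ∧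
      {C : Set (LTop.Completion G ℓ) | ∃ ω : LTop.Ends G, C = LTop.endBoundary ℓ ω} =
        {C : Set (LTop.Completion G ℓ) |
          ∃ x ∈ LTop.boundary G ℓ, C = connectedComponentIn (LTop.boundary G ℓ) x} := by
  refine ⟨LTop.isConnected_endBoundary hℓ, Set.Subset.antisymm ?_ ?_⟩
  · rintro C ⟨ω, rfl⟩
    obtain ⟨x, hx⟩ := (LTop.isConnected_endBoundary hℓ ω).nonempty
    exact ⟨x, hx.1, (LTop.connectedComponentIn_boundary hℓ hx).symm⟩
  · rintro C ⟨x, hx, rfl⟩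
    obtain ⟨ω, hω⟩ := LTop.exists_mem_endBoundary hx
    exact ⟨ω, LTop.connectedComponentIn_boundary hℓ hω⟩
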